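/- All topological groups are understood to be Hausdorff. A $k_\omega$-space is a Hausdorff space $X$ that is the union of an ascending sequence $K_1\subseteq K_2\subseteq\cdots$ of compact subsets such that $U\subseteq X$ is open if and only if $U\cap K_n$ is open in $K_n$ for every $n$. A Hausdorff space is locally $k_\omega$ if each of its points has an open neighbourhood that is a $k_\omega$-space in the induced topology, and a topological group is called locally $k_\omega$ if its underlying space is. A Hausdorff space $X$ is almost metrizable if each $x\in X$ lies in a compact set $K\subseteq X$ that has a countable basis $(U_n)_{n\in\mathbb N}$ of neighbourhoods in $X$, that is, $K\subseteq U_n^0$ for all $n$, and for each $U\subseteq X$ with $K\subseteq U^0$ there is $n$ with $U_n\subseteq U$ (where $U^0$ is the interior of $U$). A topological space is Čech complete if it is homeomorphic to the intersection of a sequence of open subsets of a compact Hausdorff space. A topological group is complete if it is complete in its left uniform structure. For an abelian topological group $G$, let $G^*$ be its Pontryagin dual, the group of all continuous homomorphisms $G\to\mathbb T=\{z\in\mathbb C:|z|=1\}$ with the compact-open topology. **Proposition.** Let $G$ be an abelian Hausdorff topological group. 1. If $G$ is locally $k_\omega$, then $G^*$ is Čech complete, and hence almost metrizable and complete. 2.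 If $G$ is almost metrizable, then $G^*$ is locally $k_\omega$ and complete. -/

import Mathlib

/-- A `k_ω`-space: a Hausdorff space `X` which is the union of an ascending sequence of compact
subsets `K n` such that a subset of `X` is open if and only if its trace on every `K n` is open
in `K n`. -/
def IsKOmegaSpace (X : Type*) [TopologicalSpace X] : Prop :=
  T2Space X ∧ ∃ K : ℕ → Set X, Monotone K ∧ (∀ n, IsCompact (K n)) ∧ (⋃ n, K n) = Set.univ ∧
    ∀ U : Set X, IsOpen U ↔ ∀ n, IsOpen ((Subtype.val : K n → X) ⁻¹' U)

/-- A locally `k_ω` space: a Hausdorff space in which every point has an open neighbourhood that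
is a `k_ω`-space in the induced topology. -/
def IsLocallyKOmegaSpace (X : Type*) [TopologicalSpace X] : Prop :=
  T2Space X ∧ ∀ x : X, ∃ U : Set X, IsOpen U ∧ x ∈ U ∧ IsKOmegaSpace U

/-- An almost metrizable space: a Hausdorff space in which every point lies in a compact set `K`
that has a countable basis `(U n)` of neighbourhoods. -/
def IsAlmostMetrizable (X : Type*) [TopologicalSpace X] : Prop :=
  T2Space X ∧ ∀ x : X, ∃ K : Set X, x ∈ K ∧ IsCompact K ∧
    ∃ U : ℕ → Set X, (∀ n, K ⊆ interior (U n)) ∧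
      ∀ V : Set X, K ⊆ interior V → ∃ n, U n ⊆ V

/-- A Čech complete space: a space homeomorphic to the intersection of a sequence of open subsets
of a compact Hausdorff space. (Replacing the compact space by the closure of the image, whose
cardinality is at most `2 ^ 2 ^ #X`, one may take it in the universe of `X`.) -/
def IsCechComplete.{u} (X : Type u) [TopologicalSpace X] : Prop :=
  ∃ (Y : Type u) (_ : TopologicalSpace Y) (_ : CompactSpace Y) (_ : T2Space Y) (f : X → Y),
    Topology.IsEmbedding f ∧
      ∃ U : ℕ → Set Y, (∀ n, IsOpen (U n)) ∧ Set.range f = ⋂ n, U n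

/-- A topological group is complete if it is complete in its left uniform structure. -/
def IsCompleteTopGroup (G : Type*) [Group G] [TopologicalSpace G] [IsTopologicalGroup G] : Prop :=
  @CompleteSpace G (IsTopologicalGroup.leftUniformSpace G)

/-! `G^*` carries uniform convergence on compact sets. An ultrafilter of characters converges
pointwise because the circle is compact; if it is uniformly Cauchy on compact sets, the limit is
continuous on them, hence continuous (`exists_le_nhds`). This gives completeness in both parts. If
`G` is locally `k_ω`, compact sets are covered by translates of compact subsets of a
`k_ω`-neighbourhood of `1`, so smallness on the countably many `K n` suffices; such a countable
criterion yields Čech completeness. If `G` is almost metrizable, take a compact `K ∋ 1` with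
neighbourhood basis `B n`. The characters with positive real part on `K` form an open set exhausted
by the compact `polar B n`. A Banach–Dieudonné argument shows that these polars determine its
topology; translation finishes the proof. -/

open Topology Filter Set Uniformity

/-! ### Čech complete, almost metrizable and `k_ω`-spaces -/

/-- A Tychonoff space with a sequence of covers such that each ultrafilter which is small of every
order converges is Čech complete. -/
theorem isCechComplete_of_ultrafilter.{u} {X : Type u} [TopologicalSpace X] [T35Space X]
    (V : ℕ → X → Set X) (hV : ∀ n x, V n x ∈ 𝓝 x)
    (h : ∀ F : Ultrafilter X, (∀ n, ∃ x, V n x ∈ F) → ∃ x, (F : Filter X) ≤ 𝓝 x) :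
    IsCechComplete X := by
  have he : IsDenseEmbedding (stoneCechUnit : X → StoneCech X) := isDenseEmbedding_stoneCechUnit
  refine ⟨StoneCech X, inferInstance, inferInstance, inferInstance, stoneCechUnit,
    he.isEmbedding,
    fun n => ⋃₀ {W | IsOpen W ∧ ∃ x, stoneCechUnit ⁻¹' W ⊆ V n x},
    fun n => isOpen_sUnion fun W hW => hW.1, ?_⟩
  apply Subset.antisymm
  · rintro _ ⟨x, rfl⟩
    refine mem_iInter.2 fun n => ?_
    obtain ⟨W, hW, hWV⟩ := he.isInducing.isOpen_iff.1 (isOpen_interior (s := V n x))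
    refine ⟨W, ⟨hW, x, hWV.trans_subset interior_subset⟩, ?_⟩
    change x ∈ stoneCechUnit ⁻¹' W
    rw [hWV]
    exact mem_interior_iff_mem_nhds.2 (hV n x)
  · intro y hy
    -- An ultrafilter on `X` tending to `y` is small of every order; its limit in `X` must map to
    -- `y`.
    have hne : (comap (stoneCechUnit : X → StoneCech X) (𝓝 y)).NeBot := he.comap_nhds_neBot y
    let F := Ultrafilter.of (comap (stoneCechUnit : X → StoneCech X) (𝓝 y))
    have hF : (F : Filter X) ≤ comap stoneCechUnit (𝓝 y) := Ultrafilter.of_le _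
    obtain ⟨x, hx⟩ := h F fun n => by
      obtain ⟨W, ⟨hW, x, hWx⟩, hyW⟩ := mem_iInter.1 hy n
      exact ⟨x, mem_of_superset (hF (preimage_mem_comap (hW.mem_nhds hyW))) hWx⟩
    exact ⟨x, tendsto_nhds_unique (f := stoneCechUnit) (l := (F : Filter X))
      ((he.continuous.tendsto x).mono_left hx) (tendsto_iff_comap.2 hF)⟩

/-- Closed neighbourhoods shrinking inside the `U n` meet in a compact subset of the range; by
compactness of `Y` they form a neighbourhood basis of it. -/
theorem IsCechComplete.isAlmostMetrizable {X : Type*} [TopologicalSpace X]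
    (hX : IsCechComplete X) : IsAlmostMetrizable X := by
  obtain ⟨Y, _, _, _, f, hf, U, hU, hfU⟩ := hX
  refine ⟨hf.t2Space, fun x => ?_⟩
  have hUx : ∀ n, U n ∈ 𝓝 (f x) := fun n =>
    (hU n).mem_nhds (mem_iInter.1 (hfU ▸ mem_range_self x) n)
  have key : ∀ s : {s : Set Y // s ∈ 𝓝 (f x)}, ∃ t : {s : Set Y // s ∈ 𝓝 (f x)},
      IsClosed t.1 ∧ t.1 ⊆ s.1 := fun s => by
    obtain ⟨t, ht, htc, hts⟩ := exists_mem_nhds_isClosed_subset s.2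
    exact ⟨⟨t, ht⟩, htc, hts⟩
  choose c hc hcs using key
  let W : ℕ → {s : Set Y // s ∈ 𝓝 (f x)} := fun n => Nat.rec (c ⟨U 0, hUx 0⟩)
    (fun n w => c ⟨U (n + 1) ∩ interior w.1, inter_mem (hUx _) (interior_mem_nhds.2 w.2)⟩) n
  have hWc : ∀ n, IsClosed (W n).1 := fun n => by cases n <;> exact hc _
  have hWU : ∀ n, (W n).1 ⊆ U n := fun n => by
    cases n
    · exact hcs _
    · exact (hcs _).trans inter_subset_left
  have hWs : ∀ n, (W (n + 1)).1 ⊆ interior (W n).1 := fun n => (hcs _).trans inter_subset_right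
  have hWa : Antitone fun n => (W n).1 :=
    antitone_nat_of_succ_le fun n => (hWs n).trans interior_subset
  have hKr : (⋂ n, (W n).1) ⊆ range f := hfU ▸ iInter_mono hWU
  refine ⟨f ⁻¹' ⋂ n, (W n).1, mem_iInter.2 fun n => mem_of_mem_nhds (W n).2,
    hf.isInducing.isCompact_preimage_iff hKr |>.2 (isClosed_iInter hWc).isCompact,
    fun n => f ⁻¹' (W n).1, fun n => ?_, fun V hV => ?_⟩
  · refine Subset.trans ?_ (preimage_interior_subset_interior_preimage hf.continuous)
    exact preimage_mono ((iInter_subset _ (n + 1)).trans (hWs n))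
  · obtain ⟨O, hO, hOV⟩ := hf.isInducing.isOpen_iff.1 (isOpen_interior (s := V))
    have hKO : (⋂ n, (W n).1) ⊆ O := by
      intro y hy
      obtain ⟨z, rfl⟩ := hKr hy
      have : z ∈ interior V := hV hy
      rwa [← hOV] at this
    obtain ⟨n, hn⟩ := exists_subset_nhds_of_isCompact' hWa.directed_ge
      (fun n => (hWc n).isCompact) hWc (fun y hy => hO.mem_nhds (hKO hy))
    exact ⟨n, (preimage_mono hn).trans (hOV.trans_subset interior_subset)⟩

/-- A compact subset of a `k_ω`-space is contained in a member of each defining sequence. -/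
theorem IsCompact.subset_of_kOmega {X : Type*} [TopologicalSpace X] [T1Space X] {K : ℕ → Set X}
    (hK : Monotone K) (hcov : (⋃ n, K n) = univ)
    (hopen : ∀ U : Set X, IsOpen U ↔ ∀ n, IsOpen ((Subtype.val : K n → X) ⁻¹' U))
    {C : Set X} (hC : IsCompact C) : ∃ n, C ⊆ K n := by
  by_contra! hcon
  choose x hxC hxK using fun n => not_subset.1 (hcon n)
  -- Each `K k` contains only finitely many `x n`, so all tails of the sequence are closed.
  have hfin : ∀ m k, (x '' Ici m ∩ K k) ⊆ x '' Iio k := by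
    rintro m k _ ⟨⟨n, -, rfl⟩, hn⟩
    exact ⟨n, not_le.1 fun h => hxK n (hK h hn), rfl⟩
  have hcl : ∀ m, IsClosed (x '' Ici m) := fun m => by
    refine isOpen_compl_iff.1 ((hopen _).2 fun k => ?_)
    rw [preimage_compl, isOpen_compl_iff]
    refine (Finite.of_finite_image (f := Subtype.val) ?_ Subtype.val_injective.injOn).isClosed
    refine ((finite_Iio k).image x).subset ((subset_inter ?_ ?_).trans (hfin m k))
    · exact image_preimage_subset _ _
    · exact Subtype.coe_image_subset _ _
  obtain ⟨z, hz⟩ := IsCompact.nonempty_iInter_of_sequence_nonempty_isCompact_isClosed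
    (fun m => x '' Ici m) (fun m => image_mono (Ici_subset_Ici.2 m.le_succ))
    (fun m => ⟨x m, m, self_mem_Ici, rfl⟩)
    (hC.of_isClosed_subset (hcl 0) (image_subset_iff.2 fun n _ => hxC n)) hcl
  obtain ⟨k, hk⟩ := mem_iUnion.1 (hcov ▸ mem_univ z)
  obtain ⟨n, hn, rfl⟩ := mem_iInter.1 hz k
  exact hxK n (hK hn hk)

theorem IsAlmostMetrizable.exists_antitone_basis {X : Type*} [TopologicalSpace X]
    (hX : IsAlmostMetrizable X) (x : X) : ∃ K : Set X, x ∈ K ∧ IsCompact K ∧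
      ∃ B : ℕ → Set X, Antitone B ∧ (∀ n, IsOpen (B n)) ∧ (∀ n, K ⊆ B n) ∧
        ∀ V, IsOpen V → K ⊆ V → ∃ n, B n ⊆ V := by
  obtain ⟨K, hxK, hK, U, hKU, hU⟩ := hX.2 x
  refine ⟨K, hxK, hK, fun n => ⋂ i ∈ Iic n, interior (U i), fun m n h => ?_, fun n => ?_,
    fun n => ?_, fun V hV hKV => ?_⟩
  · exact biInter_subset_biInter_left (Iic_subset_Iic.2 h)
  · exact (finite_Iic n).isOpen_biInter fun _ _ => isOpen_interior
  · exact subset_iInter₂ fun i _ => hKU i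
  · obtain ⟨n, hn⟩ := hU V (by rwa [hV.interior_eq])
    exact ⟨n, (biInter_subset_of_mem self_mem_Iic).trans (interior_subset.trans hn)⟩

/-- Compact sets which shrink towards a compact set have a compact union with it. -/
theorem IsCompact.union_iUnion_of_basis {X : Type*} [TopologicalSpace X] {K : Set X}
    (hK : IsCompact K) {B : ℕ → Set X} (hB : Antitone B)
    (hBK : ∀ V, IsOpen V → K ⊆ V → ∃ n, B n ⊆ V) {F : ℕ → Set X} (hF : ∀ n, IsCompact (F n))
    (hFB : ∀ n, F n ⊆ B n) : IsCompact (K ∪ ⋃ n, F n) := by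
  classical
  refine isCompact_of_finite_subcover fun {ι} U hU hcov => ?_
  obtain ⟨t, ht⟩ := hK.elim_finite_subcover U hU (subset_union_left.trans hcov)
  obtain ⟨n, hn⟩ := hBK _ (isOpen_biUnion fun i _ => hU i) ht
  obtain ⟨s, hs⟩ := ((finite_Iio n).isCompact_biUnion fun m _ => hF m).elim_finite_subcover U hU
    ((iUnion₂_subset fun m _ => subset_iUnion F m).trans (subset_union_right.trans hcov))
  refine ⟨t ∪ s, ?_⟩
  rw [Finset.set_biUnion_union]
  refine union_subset (ht.trans subset_union_left) (iUnion_subset fun m => ?_)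
  rcases lt_or_ge m n with h | h
  · exact (subset_biUnion_of_mem (u := F) (show m ∈ Iio n from h)).trans
      (hs.trans subset_union_right)
  · exact ((hFB m).trans (hB h)).trans (hn.trans subset_union_left)

/-- If `x ∈ closure A \ A`, points `a n ∈ A ∩ B n` in a closed neighbourhood of `x` missing `A ∩ K`
form with `K` a compact set. Its trace on `A` in that neighbourhood is closed and misses `K`, hence
misses some `B n`, which contains `a n`. -/
theorem IsAlmostMetrizable.compactlyCoherentSpace {X : Type*} [TopologicalSpace X]
    [RegularSpace X] (hX : IsAlmostMetrizable X) : CompactlyCoherentSpace X := by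
  have := hX.1
  refine .of_isClosed fun A hA => isClosed_of_closure_subset fun x hx => ?_
  replace hA : ∀ C, IsCompact C → IsClosed (A ∩ C) := fun C hC => by
    have := hC.isClosed.isClosedEmbedding_subtypeVal.isClosedMap _ (hA C hC)
    rwa [Subtype.image_preimage_coe, inter_comm] at this
  by_contra hxA
  obtain ⟨K, hxK, hK, B, hBa, hBo, hKB, hBK⟩ := hX.exists_antitone_basis x
  obtain ⟨W, hW, hWc, hWs⟩ := exists_mem_nhds_isClosed_subset
    ((hA K hK).isOpen_compl.mem_nhds fun h => hxA h.1)
  choose a ha haA using fun n => mem_closure_iff_nhds.1 hx (W ∩ B n)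
    (inter_mem hW ((hBo n).mem_nhds (hKB n hxK)))
  have hC : IsCompact (K ∪ ⋃ n, {a n}) :=
    hK.union_iUnion_of_basis hBa hBK (fun n => isCompact_singleton)
      fun n => singleton_subset_iff.2 (ha n).2
  obtain ⟨n, hn⟩ := hBK _ ((hA _ hC).inter hWc).isOpen_compl
    fun y hy h => hWs h.2 ⟨h.1.1, hy⟩
  exact hn (ha n).2 ⟨⟨haA n, .inr (mem_iUnion.2 ⟨n, rfl⟩)⟩, (ha n).1⟩

theorem IsKOmegaSpace.of_homeomorph {X Y : Type*} [TopologicalSpace X] [TopologicalSpace Y]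
    (hX : IsKOmegaSpace X) (e : X ≃ₜ Y) : IsKOmegaSpace Y := by
  obtain ⟨_, K, hKm, hKc, hKu, hK⟩ := hX
  refine ⟨e.t2Space, fun n => e '' K n, fun m n h => image_mono (hKm h),
    fun n => (hKc n).image e.continuous, ?_, fun U => ?_⟩
  · rw [← image_iUnion, hKu, image_univ, e.surjective.range_eq]
  · rw [← e.isOpen_preimage, hK]
    refine forall_congr' fun n => ?_
    rw [← (e.image (K n)).isOpen_preimage]
    rfl

/-! ### Metric estimates on the circle -/

theorem Circle.dist_mul_mul_le (a b c d : Circle) :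
    dist (a * b) (c * d) ≤ dist a c + dist b d := by
  change dist ((a : ℂ) * b) (c * d) ≤ dist (a : ℂ) c + dist (b : ℂ) d
  rw [dist_eq_norm, dist_eq_norm, dist_eq_norm]
  calc ‖(a : ℂ) * b - c * d‖ = ‖((a : ℂ) - c) * b + c * (b - d)‖ := by ring_nf
    _ ≤ _ := by simpa [Circle.norm_coe] using norm_add_le (((a : ℂ) - c) * b) (c * (b - d))

theorem Circle.dist_inv_mul_one (a b : Circle) : dist (a⁻¹ * b) 1 = dist a b := by
  change dist (((a⁻¹ * b : Circle) : ℂ)) (1 : ℂ) = dist (a : ℂ) b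
  rw [dist_comm (a : ℂ), dist_eq_norm, dist_eq_norm, ← one_mul ‖(b : ℂ) - a‖,
    ← Circle.norm_coe a⁻¹, ← norm_mul, mul_sub]
  simp

theorem Metric.uniformCauchySeqOn_filter_iff {ι α β : Type*} [PseudoMetricSpace β]
    {F : ι → α → β} {p : Filter ι} {s : Set α} :
    UniformCauchySeqOn F p s ↔
      ∀ ε > 0, ∀ᶠ m : ι × ι in p ×ˢ p, ∀ x ∈ s, dist (F m.1 x) (F m.2 x) < ε := by
  refine ⟨fun h ε hε => h _ (Metric.dist_mem_uniformity hε), fun h u hu => ?_⟩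
  obtain ⟨ε, hε, hu⟩ := Metric.mem_uniformity_dist.1 hu
  exact (h ε hε).mono fun m hm x hx => hu (hm x hx)

/-! ### Convergence in the dual, completeness, and the locally `k_ω` case -/

namespace PontryaginDual

variable {G : Type*} [CommGroup G] [TopologicalSpace G]

theorem isEmbedding_toContinuousMap :
    IsEmbedding fun χ : PontryaginDual G => (⟨χ, map_continuous χ⟩ : C(G, Circle)) :=
  ContinuousMonoidHom.isEmbedding_toContinuousMap G Circle

instance : T35Space (PontryaginDual G) where
  toCompletelyRegularSpace :=
    (isEmbedding_toContinuousMap (G := G)).isInducing.completelyRegularSpace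

theorem mem_nhds_iff {χ₀ : PontryaginDual G} {s : Set (PontryaginDual G)} :
    s ∈ 𝓝 χ₀ ↔ ∃ K : Set G, IsCompact K ∧ ∃ ε > 0, {χ | ∀ x ∈ K, dist (χ x) (χ₀ x) < ε} ⊆ s := by
  rw [isEmbedding_toContinuousMap.isInducing.nhds_eq_comap, mem_comap]
  have hb := nhds_basis_uniformity (Filter.HasBasis.compactConvergenceUniformity
    (α := G) (Metric.uniformity_basis_dist (α := Circle))) (x := ⟨χ₀, map_continuous χ₀⟩)
  constructor
  · rintro ⟨t, ht, hts⟩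
    obtain ⟨⟨K, ε⟩, ⟨hK, hε⟩, h⟩ := hb.mem_iff.1 ht
    exact ⟨K, hK, ε, hε, fun χ hχ => hts (h fun x hx => hχ x hx)⟩
  · rintro ⟨K, hK, ε, hε, h⟩
    exact ⟨_, hb.mem_of_mem (i := (K, ε)) ⟨hK, hε⟩, fun χ hχ => h fun x hx => hχ x hx⟩

theorem continuous_eval_const (x : G) : Continuous fun χ : PontryaginDual G => χ x :=
  (ContinuousEvalConst.continuous_eval_const (F := C(G, Circle)) x).comp isEmbedding_toContinuousMap.continuous

theorem le_nhds_iff {F : Filter (PontryaginDual G)} {χ₀ : PontryaginDual G} :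
    F ≤ 𝓝 χ₀ ↔ ∀ K : Set G, IsCompact K →
      TendstoUniformlyOn (fun (χ : PontryaginDual G) x => χ x) χ₀ F K := by
  have := isEmbedding_toContinuousMap.isInducing.tendsto_nhds_iff (f := id) (l := F) (y := χ₀)
  exact this.trans ContinuousMap.tendsto_iff_forall_isCompact_tendstoUniformlyOn

/-- An ultrafilter of characters which is uniformly Cauchy on compact sets converges, if
homomorphisms to the circle which are continuous on compact sets are continuous. -/
theorem exists_le_nhds
    (hG : ∀ f : G →* Circle, (∀ K, IsCompact K → ContinuousOn f K) → Continuous f)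
    (F : Ultrafilter (PontryaginDual G))
    (hF : ∀ K : Set G, IsCompact K →
      UniformCauchySeqOn (fun (χ : PontryaginDual G) x => χ x) (F : Filter _) K) :
    ∃ χ, (F : Filter (PontryaginDual G)) ≤ 𝓝 χ := by
  have hlim : ∀ x : G, ∃ z : Circle, Tendsto (fun χ : PontryaginDual G => χ x) F (𝓝 z) :=
    fun x => ⟨_, Ultrafilter.le_nhds_lim (F.map fun χ : PontryaginDual G => χ x)⟩
  choose f hf using hlim
  let φ : G →* Circle :=
    { toFun := f
      map_one' := tendsto_nhds_unique (hf 1) (by simp)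
      map_mul' := fun x y => tendsto_nhds_unique (hf (x * y)) (by
        simpa using (hf x).mul (hf y)) }
  have hu : ∀ K : Set G, IsCompact K →
      TendstoUniformlyOn (fun (χ : PontryaginDual G) x => χ x) φ F K :=
    fun K hK => (hF K hK).tendstoUniformlyOn_of_tendsto fun x _ => hf x
  have hφ : Continuous φ := hG φ fun K hK =>
    (hu K hK).continuousOn (Frequently.of_forall fun χ => (map_continuous χ).continuousOn)
  exact ⟨(⟨φ, hφ⟩ : G →ₜ* Circle), le_nhds_iff.2 hu⟩

variable [IsTopologicalGroup G]

/-- To be uniformly Cauchy on compact sets is a local condition for ultrafilters of characters. -/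
theorem uniformCauchySeqOn_of_nhds_one (F : Ultrafilter (PontryaginDual G))
    (hF : ∀ ε > 0, ∃ V ∈ 𝓝 (1 : G), ∀ C ⊆ V, IsCompact C →
      ∀ᶠ m : PontryaginDual G × PontryaginDual G in (F : Filter _) ×ˢ (F : Filter _),
        ∀ x ∈ C, dist (m.1 x) (m.2 x) < ε)
    {K : Set G} (hK : IsCompact K) :
    UniformCauchySeqOn (fun (χ : PontryaginDual G) x => χ x) (F : Filter _) K := by
  refine Metric.uniformCauchySeqOn_filter_iff.2 fun ε hε => ?_
  obtain ⟨V, hV, hVC⟩ := hF (ε / 2) (half_pos hε)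
  obtain ⟨W, hW, hWc, hWV⟩ := exists_mem_nhds_isClosed_subset hV
  obtain ⟨t, -, ht⟩ := hK.elim_nhds_subcover (fun g => (g⁻¹ * ·) ⁻¹' W) fun g _ =>
    (continuous_const_mul g⁻¹).continuousAt.preimage_mem_nhds (by simpa using hW)
  have h1 : ∀ g : G,
      ∀ᶠ m : PontryaginDual G × PontryaginDual G in (F : Filter _) ×ˢ (F : Filter _),
        dist (m.1 g) (m.2 g) < ε / 2 := fun g => by
    have hz := Ultrafilter.le_nhds_lim (F.map fun χ : PontryaginDual G => χ g)
    have hc : Cauchy (Filter.map (fun χ : PontryaginDual G => χ g) F) := cauchy_nhds.mono hz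
    have := hc.2
    rw [prod_map_map_eq] at this
    exact this (Metric.dist_mem_uniformity (half_pos hε))
  have h2 : ∀ g : G,
      ∀ᶠ m : PontryaginDual G × PontryaginDual G in (F : Filter _) ×ˢ (F : Filter _),
        ∀ x ∈ W ∩ (g⁻¹ * ·) '' K, dist (m.1 x) (m.2 x) < ε / 2 := fun g =>
    hVC _ (inter_subset_left.trans hWV) ((hK.image (continuous_const_mul g⁻¹)).inter_left hWc)
  filter_upwards [(eventually_all_finset t).2 fun g _ => (h1 g).and (h2 g)] with m hm x hx
  obtain ⟨g, hg, hxg⟩ := mem_iUnion₂.1 (ht hx)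
  have := Circle.dist_mul_mul_le (m.1 g) (m.1 (g⁻¹ * x)) (m.2 g) (m.2 (g⁻¹ * x))
  rw [← _root_.map_mul, ← _root_.map_mul, mul_inv_cancel_left] at this
  linarith [(hm g hg).1, (hm g hg).2 _ ⟨hxg, mem_image_of_mem _ hx⟩]

theorem isCompleteTopGroup
    (hG : ∀ f : G →* Circle, (∀ K, IsCompact K → ContinuousOn f K) → Continuous f) :
    IsCompleteTopGroup (PontryaginDual G) := by
  let := IsTopologicalGroup.leftUniformSpace (PontryaginDual G)
  refine ⟨fun {f} hf => ?_⟩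
  have := hf.1
  have hFf := Ultrafilter.of_le f
  obtain ⟨χ, hχ⟩ := exists_le_nhds hG (Ultrafilter.of f) fun K hK => by
    refine Metric.uniformCauchySeqOn_filter_iff.2 fun ε hε => ?_
    have h1 : {χ : PontryaginDual G | ∀ x ∈ K, dist (χ x) 1 < ε} ∈ 𝓝 1 :=
      mem_nhds_iff.2 ⟨K, hK, ε, hε, fun χ hχ => hχ⟩
    have h2 := (Filter.prod_mono hFf hFf).trans hf.2 (preimage_mem_comap h1)
    refine mem_of_superset h2 fun m hm x hx => ?_
    rw [← Circle.dist_inv_mul_one]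
    exact hm x hx
  exact ⟨χ, le_nhds_of_cauchy_adhp hf (ClusterPt.of_le_nhds hχ |>.mono hFf)⟩

theorem continuous_of_continuousOn_kOmega {U : Set G} (hU : IsOpen U) (h1 : 1 ∈ U) {K : ℕ → Set U}
    (hK : ∀ O : Set U, IsOpen O ↔ ∀ n, IsOpen ((Subtype.val : K n → U) ⁻¹' O))
    (f : G →* Circle) (hf : ∀ n, ContinuousOn f (Subtype.val '' K n)) : Continuous f := by
  have hfU : Continuous fun x : U => f x := continuous_def.2 fun O hO => (hK _).2 fun n =>
    hO.preimage ((hf n).comp_continuous (f := fun x : K n => (x.1 : G)) (by fun_prop)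
      fun x => mem_image_of_mem _ x.2)
  refine continuous_of_continuousAt_one f ?_
  exact (continuousOn_iff_continuous_domRestrict.2 hfU).continuousAt (hU.mem_nhds h1)

theorem of_isLocallyKOmegaSpace (hG : IsLocallyKOmegaSpace G) :
    IsCechComplete (PontryaginDual G) ∧ IsCompleteTopGroup (PontryaginDual G) := by
  have := hG.1
  obtain ⟨U, hU, h1U, -, K, hKm, hKc, hKu, hK⟩ := hG.2 1
  have hc : ∀ n, IsCompact (Subtype.val '' K n) := fun n => (hKc n).image continuous_subtype_val
  have hcont : ∀ f : G →* Circle, (∀ K, IsCompact K → ContinuousOn f K) → Continuous f :=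
    fun f hf => continuous_of_continuousOn_kOmega hU h1U hK f fun n => hf _ (hc n)
  refine ⟨isCechComplete_of_ultrafilter
    (fun n χ => {χ' | ∀ x ∈ Subtype.val '' K n, dist (χ' x) (χ x) < 1 / ((n : ℝ) + 1)})
    (fun n χ => mem_nhds_iff.2 ⟨_, hc n, _, Nat.one_div_pos_of_nat, Subset.rfl⟩)
    fun F hF => exists_le_nhds hcont F fun C hC => ?_, isCompleteTopGroup hcont⟩
  refine uniformCauchySeqOn_of_nhds_one F (fun ε hε => ⟨U, hU.mem_nhds h1U, fun C hCU hC => ?_⟩) hC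
  obtain ⟨n, hn⟩ := IsCompact.subset_of_kOmega hKm hKu hK
    (IsInducing.subtypeVal.isCompact_preimage_iff (K := C) (by simpa using hCU) |>.2 hC)
  obtain ⟨N, hN⟩ := exists_nat_one_div_lt (half_pos hε)
  obtain ⟨χ, hχ⟩ := hF (max n N)
  refine mem_of_superset (prod_mem_prod hχ hχ) fun m hm x hx => ?_
  have hxK : x ∈ Subtype.val '' K (max n N) :=
    ⟨⟨x, hCU hx⟩, hKm (le_max_left n N) (hn hx), rfl⟩
  have hle : 1 / (((max n N : ℕ) : ℝ) + 1) ≤ 1 / ((N : ℝ) + 1) :=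
    Nat.one_div_le_one_div (le_max_right n N)
  have h1 := hm.1 x hxK
  have h2 := hm.2 x hxK
  linarith [dist_triangle_right (m.1 x) (m.2 x) (χ x)]

end PontryaginDual

/-! ### Equicontinuity and compact polars -/

theorem Circle.re_le_one (z : Circle) : (z : ℂ).re ≤ 1 :=
  (Complex.re_le_norm _).trans_eq z.norm_coe

theorem Circle.re_sq_add_im_sq (z : Circle) : (z : ℂ).re ^ 2 + (z : ℂ).im ^ 2 = 1 := by
  have := z.normSq_coe
  rw [Complex.normSq_apply] at this
  linarith

theorem Circle.dist_one_sq (z : Circle) : dist z 1 ^ 2 = 2 * (1 - (z : ℂ).re) := by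
  change dist (z : ℂ) 1 ^ 2 = _
  rw [dist_eq_norm, Complex.sq_norm, Complex.normSq_apply]
  simp only [Complex.sub_re, Complex.one_re, Complex.sub_im, Complex.one_im]
  linarith [z.re_sq_add_im_sq]

theorem Circle.re_sub_re_le_dist (z w : Circle) : (z : ℂ).re - (w : ℂ).re ≤ dist z w := by
  change _ ≤ dist (z : ℂ) w
  rw [dist_eq_norm, ← Complex.sub_re]
  exact Complex.re_le_norm _

theorem Circle.continuous_re : Continuous fun z : Circle => (z : ℂ).re :=
  Complex.continuous_re.comp continuous_subtype_val

/-- If the first `k` iterated squares of `z` lie in the right half plane, then `z` is close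
to `1`. -/
theorem Circle.one_sub_re_le_of_pow (k : ℕ) (z : Circle)
    (h : ∀ j ≤ k, 0 ≤ ((z ^ 2 ^ j : Circle) : ℂ).re) : 1 - (z : ℂ).re ≤ (1 / 2) ^ k := by
  induction k generalizing z with
  | zero => simpa using h 0 le_rfl
  | succ k ih =>
    have h0 : 0 ≤ (z : ℂ).re := by simpa using h 0 (Nat.zero_le _)
    have h1 := ih (z ^ 2) fun j hj => by
      rw [← pow_mul, ← pow_succ']
      exact h (j + 1) (Nat.succ_le_succ hj)
    have h2 : ((z ^ 2 : Circle) : ℂ).re = (z : ℂ).re ^ 2 - (z : ℂ).im ^ 2 := by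
      simp [sq]
    rw [h2] at h1
    rw [pow_succ]
    -- With `r = Re z ≥ 0`, `1 - Re z² = 2(1 - r)(1 + r) ≥ 2(1 - r)`.
    nlinarith [z.re_sq_add_im_sq, z.re_le_one]

/-- Equicontinuity at `1`: `V` consists of points whose first iterated squares all lie in `U`. -/
theorem PontryaginDual.exists_nhds_one_dist_lt {G : Type*} [CommGroup G] [TopologicalSpace G]
    [IsTopologicalGroup G] {U : Set G} (hU : U ∈ 𝓝 1) {ε : ℝ} (hε : 0 < ε) :
    ∃ V ∈ 𝓝 (1 : G), ∀ χ : PontryaginDual G, (∀ x ∈ U, 0 ≤ (χ x : ℂ).re) →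
      ∀ v ∈ V, dist (χ v) 1 < ε := by
  obtain ⟨k, hk⟩ := exists_pow_lt_of_lt_one (show 0 < ε ^ 2 / 2 by positivity)
    (show (1 / 2 : ℝ) < 1 by norm_num)
  refine ⟨⋂ j ∈ Iic k, (· ^ 2 ^ j) ⁻¹' U, (biInter_mem (finite_Iic k)).2 fun j _ =>
    (continuous_pow (2 ^ j)).continuousAt.preimage_mem_nhds (by simpa using hU),
    fun χ hχ v hv => ?_⟩
  have h1 := Circle.one_sub_re_le_of_pow k (χ v) fun j hj => by
    rw [← _root_.map_pow]
    exact hχ _ (mem_iInter₂.1 hv j hj)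
  refine lt_of_pow_lt_pow_left₀ 2 hε.le ?_
  rw [Circle.dist_one_sq]
  linarith

/-- An Ascoli argument: equicontinuity near `1` makes every ultrafilter on this pointwise closed set
uniformly Cauchy on compact sets. -/
theorem PontryaginDual.isCompact_setOf_le_re {G : Type*} [CommGroup G] [TopologicalSpace G]
    [IsTopologicalGroup G]
    (hG : ∀ f : G →* Circle, (∀ K, IsCompact K → ContinuousOn f K) → Continuous f)
    {U : Set G} (hU : U ∈ 𝓝 1) {c : ℝ} (hc : 0 ≤ c) :
    IsCompact {χ : PontryaginDual G | ∀ x ∈ U, c ≤ (χ x : ℂ).re} := by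
  have hcl : IsClosed {χ : PontryaginDual G | ∀ x ∈ U, c ≤ (χ x : ℂ).re} := by
    simp only [ofPred_forall]
    exact isClosed_biInter fun x _ => isClosed_le continuous_const
      (Circle.continuous_re.comp (continuous_eval_const x))
  refine isCompact_iff_ultrafilter_le_nhds.2 fun F hF => ?_
  have hLF := le_principal_iff.1 hF
  obtain ⟨χ, hχ⟩ := exists_le_nhds hG F fun K hK => uniformCauchySeqOn_of_nhds_one F
    (fun ε hε => by
      obtain ⟨V, hV, h⟩ := exists_nhds_one_dist_lt hU (half_pos hε)
      refine ⟨V, hV, fun C hCV _ => mem_of_superset (prod_mem_prod hLF hLF) fun m hm x hx => ?_⟩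
      linarith [h m.1 (fun x hx => hc.trans (hm.1 x hx)) x (hCV hx),
        h m.2 (fun x hx => hc.trans (hm.2 x hx)) x (hCV hx),
        dist_triangle_right (m.1 x) (m.2 x) 1]) hK
  exact ⟨χ, hcl.mem_of_tendsto (f := id) hχ hLF, hχ⟩

/-! ### The Banach–Dieudonné argument -/

section BanachDieudonne

variable {G : Type*} [CommGroup G] [TopologicalSpace G] {K : Set G} {B : ℕ → Set G}

/-- The characters whose real part is bounded below by `1 / (n + 1)` on `B n`. -/
def PontryaginDual.polar (B : ℕ → Set G) (n : ℕ) : Set (PontryaginDual G) :=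
  {χ | ∀ x ∈ B n, 1 / ((n : ℝ) + 1) ≤ (χ x : ℂ).re}

/-- The characters which map `K` to the open right half plane. -/
def PontryaginDual.posOn (K : Set G) : Set (PontryaginDual G) :=
  {χ | ∀ x ∈ K, 0 < (χ x : ℂ).re}

theorem PontryaginDual.isOpen_posOn (hK : IsCompact K) : IsOpen (posOn K) :=
  (ContinuousMap.isOpen_setOfPred_mapsTo hK
    (isOpen_lt continuous_const Circle.continuous_re)).preimage
      isEmbedding_toContinuousMap.continuous

theorem PontryaginDual.polar_subset_posOn (hKB : ∀ n, K ⊆ B n) (n : ℕ) :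
    polar B n ⊆ posOn K :=
  fun _ hχ x hx => Nat.one_div_pos_of_nat.trans_le (hχ x (hKB n hx))

theorem PontryaginDual.monotone_polar (hB : Antitone B) : Monotone (polar B) :=
  fun _ _ h _ hχ x hx => (Nat.one_div_le_one_div h).trans (hχ x (hB h hx))

/-- The real part of `χ` has a positive minimum on `K`; a smaller positive bound holds on an open
set around `K`, hence on some `B n`. -/
theorem PontryaginDual.exists_mem_polar (hK : IsCompact K) (h1 : 1 ∈ K) (hB : Antitone B)
    (hBK : ∀ V, IsOpen V → K ⊆ V → ∃ n, B n ⊆ V) {χ : PontryaginDual G} (hχ : χ ∈ posOn K) :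
    ∃ n, χ ∈ polar B n := by
  have hc : Continuous fun x => (χ x : ℂ).re := Circle.continuous_re.comp (map_continuous χ)
  obtain ⟨x₀, hx₀, hmin⟩ := hK.exists_isMinOn ⟨1, h1⟩ hc.continuousOn
  obtain ⟨N, hN⟩ := exists_nat_one_div_lt (hχ x₀ hx₀)
  obtain ⟨n, hn⟩ := hBK {x | 1 / ((N : ℝ) + 1) < (χ x : ℂ).re} (isOpen_lt continuous_const hc)
    fun x hx => hN.trans_le (hmin hx)
  exact ⟨max n N, fun x hx => (Nat.one_div_le_one_div (le_max_right n N)).trans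
    (le_of_lt (hn (hB (le_max_left n N) hx)))⟩

/-- A Banach–Dieudonné theorem: the topology of `posOn K` is determined by the polars. -/
theorem PontryaginDual.exists_nhds_of_isClosed_inter_polar [IsTopologicalGroup G]
    (hpolar : ∀ n, IsCompact (polar B n)) (hK : IsCompact K) (h1 : 1 ∈ K) (hB : Antitone B)
    (hBK : ∀ V, IsOpen V → K ⊆ V → ∃ n, B n ⊆ V)
    {Z : Set (PontryaginDual G)} (hZ : ∀ n, IsClosed (Z ∩ polar B n)) {χ₀ : PontryaginDual G}
    (hχ₀ : χ₀ ∈ posOn K) (hχ₀Z : χ₀ ∉ Z) : ∃ N ∈ 𝓝 χ₀, ∀ χ ∈ N, χ ∈ posOn K → χ ∉ Z := by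
  obtain ⟨n₀, hn₀⟩ := exists_mem_polar hK h1 hB hBK hχ₀
  -- This makes `1 / (m + n + 1)` at most half of `1 / (n₀ + 1)`: a character outside `polar B (m +
  -- n)` then differs from `χ₀` by more than `ε` somewhere on `B (m + n)`.
  set m := 2 * n₀ + 1
  obtain ⟨C₀, hC₀, ε₀, hε₀, hN₀⟩ := mem_nhds_iff.1
    ((hZ m).isOpen_compl.mem_nhds fun h => hχ₀Z h.1)
  have hn₀' : (0 : ℝ) < 1 / ((n₀ : ℝ) + 1) := Nat.one_div_pos_of_nat
  obtain ⟨ε, hε, hεε₀, hεn⟩ : ∃ ε > 0, ε < ε₀ ∧ ε ≤ 1 / ((n₀ : ℝ) + 1) / 2 :=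
    ⟨min (ε₀ / 2) (1 / ((n₀ : ℝ) + 1) / 2), lt_min (half_pos hε₀) (half_pos hn₀'),
      (min_le_left _ _).trans_lt (half_lt_self hε₀), min_le_right _ _⟩
  let P : ℕ → Set G → Prop := fun n C =>
    ∀ χ ∈ Z ∩ polar B (m + n), ∃ x ∈ C, ε < dist (χ x) (χ₀ x)
  -- Compactness of `Z ∩ polar B (m + n + 1)` allows the separating set to be enlarged by finitely
  -- many points of `B (m + n)`.
  have hstep : ∀ n C, ∃ F : Set G, F.Finite ∧ F ⊆ B (m + n) ∧ (P n C → P (n + 1) (C ∪ F)) := by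
    intro n C
    by_cases hP : P n C
    swap
    · exact ⟨∅, finite_empty, empty_subset _, fun h => absurd h hP⟩
    obtain ⟨b, hbs, hbf, hb⟩ := ((hpolar (m + (n + 1))).of_isClosed_subset (hZ (m + (n + 1)))
      inter_subset_right).elim_finite_subcover_image (b := C ∪ B (m + n))
      (c := fun x => {χ | ε < dist (χ x) (χ₀ x)})
      (fun x _ => isOpen_lt continuous_const ((continuous_eval_const x).dist continuous_const))
      fun χ hχ => by
        by_cases hχn : χ ∈ polar B (m + n)
        · obtain ⟨x, hx, hlt⟩ := hP χ ⟨hχ.1, hχn⟩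
          exact mem_biUnion (.inl hx) hlt
        · simp only [polar, mem_ofPred_eq, not_forall, not_le] at hχn
          obtain ⟨x, hx, hlt⟩ := hχn
          refine mem_biUnion (.inr hx) (show ε < dist (χ x) (χ₀ x) from ?_)
          have e1 := hn₀ x (hB (show n₀ ≤ m + n by omega) hx)
          have e2 := Circle.re_sub_re_le_dist (χ₀ x) (χ x)
          have e3 : 1 / (((m + n : ℕ) : ℝ) + 1) ≤ 1 / ((n₀ : ℝ) + 1) / 2 := by
            rw [div_div]
            refine one_div_le_one_div_of_le (by positivity) ?_
            have : (n₀ + 1) * 2 ≤ m + n + 1 := by omega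
            exact_mod_cast this
          rw [dist_comm] at e2
          linarith
    refine ⟨b ∩ B (m + n), hbf.inter_of_left _, inter_subset_right, fun _ χ hχ => ?_⟩
    obtain ⟨x, hx, hlt⟩ := mem_iUnion₂.1 (hb hχ)
    exact ⟨x, (hbs hx).imp id fun h => ⟨hx, h⟩, hlt⟩
  choose Φ hΦf hΦB hΦ using hstep
  let E : ℕ → Set G := fun n => Nat.rec C₀ (fun n C => C ∪ Φ n C) n
  have hE : ∀ n, P n (E n) := fun n => by
    induction n with
    | zero =>
      intro χ hχ
      by_contra! hcon
      exact hN₀ (fun x hx => (hcon x hx).trans_lt hεε₀) hχ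
    | succ n ih => exact hΦ n (E n) ih
  have hEs : ∀ n, E n ⊆ C₀ ∪ (K ∪ ⋃ n, Φ n (E n)) := fun n => by
    induction n with
    | zero => exact subset_union_left
    | succ n ih =>
      exact union_subset ih ((subset_iUnion (fun n => Φ n (E n)) n).trans
        (subset_union_right.trans subset_union_right))
  -- The added finite sets shrink towards `K`, so one compact set separates `χ₀` from all of `Z ∩
  -- posOn K`.
  have hC : IsCompact (C₀ ∪ (K ∪ ⋃ n, Φ n (E n))) :=
    hC₀.union (hK.union_iUnion_of_basis hB hBK (fun n => (hΦf n _).isCompact)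
      fun n => (hΦB n _).trans (hB (Nat.le_add_left n m)))
  refine ⟨_, mem_nhds_iff.2 ⟨_, hC, ε, hε, Subset.rfl⟩, fun χ hχ hχK hχZ => ?_⟩
  obtain ⟨n, hn⟩ := exists_mem_polar hK h1 hB hBK hχK
  obtain ⟨x, hx, hlt⟩ := hE n χ ⟨hχZ, monotone_polar hB (Nat.le_add_left n m) hn⟩
  exact lt_asymm hlt (hχ x (hEs n hx))

theorem PontryaginDual.isKOmegaSpace_posOn [IsTopologicalGroup G]
    (hpolar : ∀ n, IsCompact (polar B n))
    (hK : IsCompact K) (h1 : 1 ∈ K) (hB : Antitone B) (hKB : ∀ n, K ⊆ B n)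
    (hBK : ∀ V, IsOpen V → K ⊆ V → ∃ n, B n ⊆ V) :
    IsKOmegaSpace (posOn K) := by
  refine ⟨inferInstance, fun n => Subtype.val ⁻¹' polar B n,
    fun m n h => preimage_mono (monotone_polar hB h), fun n => ?_, ?_, fun W => ⟨fun hW n =>
      hW.preimage continuous_subtype_val, fun hW => ?_⟩⟩
  · refine (IsInducing.subtypeVal.isCompact_preimage_iff ?_).2 (hpolar n)
    rw [Subtype.range_coe]
    exact polar_subset_posOn hKB n
  · refine eq_univ_of_forall fun χ => mem_iUnion.2 ?_
    exact exists_mem_polar hK h1 hB hBK χ.2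
  · have hZ : ∀ n, IsClosed (Subtype.val '' Wᶜ ∩ polar B n) := fun n => by
      have hcpt : IsCompact ((Subtype.val : posOn K → PontryaginDual G) ⁻¹' polar B n) :=
        (IsInducing.subtypeVal.isCompact_preimage_iff (by
          rw [Subtype.range_coe]; exact polar_subset_posOn hKB n)).2 (hpolar n)
      have := isCompact_iff_compactSpace.1 hcpt
      have h2 := (((hW n).isClosed_compl.isCompact.image continuous_subtype_val).image
        continuous_subtype_val).isClosed
      convert h2 using 1
      rw [← preimage_compl, Subtype.image_preimage_coe, ← image_inter_preimage, inter_comm]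
    refine isOpen_iff_mem_nhds.2 fun χ hχ => ?_
    obtain ⟨N, hN, h⟩ := exists_nhds_of_isClosed_inter_polar hpolar hK h1 hB hBK hZ χ.2
      fun ⟨ψ, hψ, he⟩ => hψ (Subtype.ext he ▸ hχ)
    refine mem_of_superset (continuous_subtype_val.continuousAt.preimage_mem_nhds hN)
      fun ψ hψ => ?_
    by_contra hψW
    exact h ψ hψ ψ.2 ⟨ψ, hψW, rfl⟩

end BanachDieudonne

theorem PontryaginDual.of_isAlmostMetrizable {G : Type*} [CommGroup G] [TopologicalSpace G]
    [IsTopologicalGroup G] (hG : IsAlmostMetrizable G) :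
    IsLocallyKOmegaSpace (PontryaginDual G) ∧ IsCompleteTopGroup (PontryaginDual G) := by
  have := hG.compactlyCoherentSpace
  have hcont : ∀ f : G →* Circle, (∀ K, IsCompact K → ContinuousOn f K) → Continuous f :=
    fun f hf => CompactlyCoherentSpace.isCoherentWith.continuous_iff.2 hf
  refine ⟨⟨inferInstance, fun χ => ?_⟩, isCompleteTopGroup hcont⟩
  obtain ⟨K, h1, hK, B, hB, hBo, hKB, hBK⟩ := hG.exists_antitone_basis 1
  have hpolar : ∀ n, IsCompact (polar B n) := fun n =>
    isCompact_setOf_le_re hcont ((hBo n).mem_nhds (hKB n h1)) Nat.one_div_pos_of_nat.le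
  -- `posOn K` is a neighbourhood of the trivial character; its translate by `χ` serves at `χ`.
  refine ⟨Homeomorph.mulLeft χ '' posOn K, (Homeomorph.mulLeft χ).isOpenMap _ (isOpen_posOn hK),
    ⟨1, fun x _ => by simp, mul_one χ⟩,
    (isKOmegaSpace_posOn hpolar hK h1 hB hKB hBK).of_homeomorph ((Homeomorph.mulLeft χ).image _)⟩

theorem mainTheorem5 (G : Type*) [CommGroup G] [TopologicalSpace G] [IsTopologicalGroup G] :
    (IsLocallyKOmegaSpace G →
      IsCechComplete (PontryaginDual G) ∧ IsAlmostMetrizable (PontryaginDual G) ∧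
        IsCompleteTopGroup (PontryaginDual G)) ∧
    (IsAlmostMetrizable G →
      IsLocallyKOmegaSpace (PontryaginDual G) ∧ IsCompleteTopGroup (PontryaginDual G)) :=
  ⟨fun h => ⟨(PontryaginDual.of_isLocallyKOmegaSpace h).1,
    (PontryaginDual.of_isLocallyKOmegaSpace h).1.isAlmostMetrizable,
    (PontryaginDual.of_isLocallyKOmegaSpace h).2⟩, PontryaginDual.of_isAlmostMetrizable⟩
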